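/- Let $N\ge 3$ and $d_1,\dots,d_N\ge 2$ be integers, and put $\mathcal H=\bigotimes_{j=1}^N\mathbb C^{d_j}$, $d_T=\prod_{j} d_j$, $d_S=\sum_{j} d_j$. Throughout, $\log$ is the logarithm to base $2$ and $\ln$ the natural logarithm. A state is a positive semidefinite operator of trace one, and $\mathrm{SEP}$ denotes the set of fully separable states on $\mathcal H$, i.e. the convex combinations of tensor products $\sigma_1\otimes\cdots\otimes\sigma_N$ of single-party states. For a state $\rho$ on $\mathcal H$ define * the geometric measure $G(\rho)=-2\log\Lambda(\rho)$, where $\Lambda^2(\rho)=\max_{\sigma\in\mathrm{SEP}}\operatorname{tr}(\rho\sigma)$; * the relative entropy of entanglement $E_{\mathrm R}(\rho)=\min_{\sigma\in\mathrm{SEP}}S(\rho\|\sigma)$, where $S(\rho\|\sigma)=\operatorname{tr}\rho(\log\rho-\log\sigma)$, with value $+\infty$ unless the support of $\rho$ lies in that of $\sigma$; * the logarithmic global robustness $R_{\mathrm L}(\rho)=\log(1+R_{\mathrm g}(\rho))$, where $R_{\mathrm g}(\rho)=\min\{t\ge 0:\ \exists\text{ a state }\Delta\text{ with }\frac{\rho+t\Delta}{1+t}\in\mathrm{SEP}\}$.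 For a unit vector $\psi\in\mathcal H$ write $G(\psi)$, $E_{\mathrm R}(\psi)$, $R_{\mathrm L}(\psi)$ for the values at $|\psi\rangle\langle\psi|$. (a) Let $\psi$ be a pure state drawn according to the Haar measure (the normalized invariant measure on the unit sphere of $\mathcal H$). Then $$\Pr\Bigl[G(\psi)<\log d_T-\log(d_S\ln d_T)-\log\tfrac92\Bigr]<d_T^{-d_S},$$ $$\Pr\Bigl[G(\psi)<\tfrac12\log d_T\Bigr]<\exp\Bigl[-\tfrac23\sqrt{d_T}+d_S\ln(59Nd_T)\Bigr].$$ (b) Let $\psi$ be a pure state with real entries in the computational (product) basis drawn according to the Haar measure (the normalized invariant measure on the unit sphere of the real vectors). Then $$\Pr\Bigl[G(\psi)<\log d_T-\log(d_S\ln d_T)-\log 9\Bigr]<d_T^{-d_S},$$ $$\Pr\Bigl[G(\psi)<\tfrac12\log d_T\Bigr]<\exp\Bigl[-\tfrac13\sqrt{d_T}+d_S\ln(59Nd_T)\Bigr].$$ (c) All four bounds in (a) and (b) remain true, with the same thresholds and the same right-hand sides, when the event that $G(\psi)$ is smaller than the threshold is replaced by the event that $E_{\mathrm R}(\psi)$ or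 $R_{\mathrm L}(\psi)$ (at least one of them) is smaller than the threshold. -/

import Mathlib

open scoped ComplexOrder

noncomputable section

namespace QState

/-- Labels of the computational (product) basis of `⨂ⱼ ℂ^(d j)`. -/
abbrev Idx {N : ℕ} (d : Fin N → ℕ) : Type := (j : Fin N) → Fin (d j)

/-- The Hilbert space `⨂ⱼ ℂ^(d j)` in coordinates with respect to its computational basis. -/
abbrev Ket {N : ℕ} (d : Fin N → ℕ) : Type := EuclideanSpace ℂ (Idx d)

/-- Kets whose entries in the computational basis are real. -/
abbrev RealKet {N : ℕ} (d : Fin N → ℕ) : Type := EuclideanSpace ℝ (Idx d)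

/-- `d_T`, the dimension of the whole space. -/
def totalDim {N : ℕ} (d : Fin N → ℕ) : ℕ := ∏ j, d j

/-- `d_S`, the sum of the local dimensions. -/
def sumDim {N : ℕ} (d : Fin N → ℕ) : ℕ := ∑ j, d j

/-- Density matrices. -/
def IsState {n : Type*} [Fintype n] (ρ : Matrix n n ℂ) : Prop :=
  ρ.PosSemidef ∧ ρ.trace = 1

/-- The density matrix `|ψ⟩⟨ψ|`. -/
def pureState {n : Type*} (ψ : EuclideanSpace ℂ n) : Matrix n n ℂ :=
  Matrix.of fun i k => ψ i * star (ψ k)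

/-- A real ket, seen as a ket. -/
def RealKet.toKet {N : ℕ} {d : Fin N → ℕ} (ψ : RealKet d) : Ket d :=
  WithLp.toLp 2 fun i => ((ψ i : ℝ) : ℂ)

/-- The tensor product `⨂ⱼ (σ j)` of single-party matrices. -/
def tensor {N : ℕ} {d : Fin N → ℕ} (σ : (j : Fin N) → Matrix (Fin (d j)) (Fin (d j)) ℂ) :
    Matrix (Idx d) (Idx d) ℂ :=
  Matrix.of fun i k => ∏ j, σ j (i j) (k j)

/-- The set of fully separable states: the convex combinations of tensor products of
single-party states. -/
def SEP {N : ℕ} (d : Fin N → ℕ) : Set (Matrix (Idx d) (Idx d) ℂ) :=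
  convexHull ℝ {τ | ∃ σ : (j : Fin N) → Matrix (Fin (d j)) (Fin (d j)) ℂ,
    (∀ j, IsState (σ j)) ∧ τ = tensor σ}

/-- `Λ(ρ)`, where `Λ(ρ)²` is the maximal overlap `tr (ρ σ)` with a separable state `σ`. -/
def maxOverlap {N : ℕ} {d : Fin N → ℕ} (ρ : Matrix (Idx d) (Idx d) ℂ) : ℝ :=
  Real.sqrt (sSup ((fun σ => (ρ * σ).trace.re) '' SEP d))

/-- The geometric measure of entanglement. -/
def GM {N : ℕ} {d : Fin N → ℕ} (ρ : Matrix (Idx d) (Idx d) ℂ) : ℝ :=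
  -2 * Real.logb 2 (maxOverlap ρ)

open Classical in
/-- The quantum relative entropy `tr ρ (log₂ ρ - log₂ σ)`, which is `+∞` unless the support of `ρ`
lies in the support of `σ`. The functional calculus uses `log₂ 0 = 0`, so that the logarithms are
taken on the supports. -/
def relEntropy {n : Type*} [Fintype n] (ρ σ : Matrix n n ℂ) : EReal :=
  if ∀ v : n → ℂ, σ.mulVec v = 0 → ρ.mulVec v = 0 then
    (((ρ * (cfc (Real.logb 2) ρ - cfc (Real.logb 2) σ)).trace.re : ℝ) : EReal)
  else ⊤

/-- The relative entropy of entanglement. -/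
def REE {N : ℕ} {d : Fin N → ℕ} (ρ : Matrix (Idx d) (Idx d) ℂ) : EReal :=
  ⨅ σ ∈ SEP d, relEntropy ρ σ

/-- The global robustness of entanglement. -/
def GR {N : ℕ} {d : Fin N → ℕ} (ρ : Matrix (Idx d) (Idx d) ℂ) : ℝ :=
  sInf {t : ℝ | 0 ≤ t ∧ ∃ Δ : Matrix (Idx d) (Idx d) ℂ,
    IsState Δ ∧ (1 + t)⁻¹ • (ρ + t • Δ) ∈ SEP d}

/-- The logarithmic global robustness of entanglement. -/
def LGR {N : ℕ} {d : Fin N → ℕ} (ρ : Matrix (Idx d) (Idx d) ℂ) : ℝ :=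
  Real.logb 2 (1 + GR ρ)

open MeasureTheory in
/-- The normalized surface measure on the unit sphere of `E`. -/
def sphereHaar (E : Type*) [NormedAddCommGroup E] [InnerProductSpace ℝ E]
    [FiniteDimensional ℝ E] [MeasurableSpace E] [BorelSpace E] :
    Measure (Metric.sphere (0 : E) 1) :=
  ((volume : Measure E).toSphere Set.univ)⁻¹ • (volume : Measure E).toSphere

open MeasureTheory in
/-- The normalized surface measure is a probability measure. -/
theorem isProbabilityMeasure_sphereHaar (E : Type*) [NormedAddCommGroup E]
    [InnerProductSpace ℝ E] [FiniteDimensional ℝ E] [MeasurableSpace E] [BorelSpace E]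
    [Nontrivial E] : IsProbabilityMeasure (sphereHaar E) := by
  constructor
  rw [sphereHaar, Measure.smul_apply, smul_eq_mul]
  refine ENNReal.inv_mul_cancel ?_ (measure_ne_top _ _)
  rw [Ne, Measure.measure_univ_eq_zero]
  exact Measure.toSphere_ne_zero _

open MeasureTheory Pointwise in
/-- The normalized surface measure is invariant under every linear isometry of `E`: it is the
Haar measure on the unit sphere. -/
theorem sphereHaar_invariant (E : Type*) [NormedAddCommGroup E]
    [InnerProductSpace ℝ E] [FiniteDimensional ℝ E] [MeasurableSpace E] [BorelSpace E]
    (U : E ≃ₗᵢ[ℝ] E) {s : Set E} (hs : MeasurableSet s) :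
    sphereHaar E (Subtype.val ⁻¹' (U ⁻¹' s)) = sphereHaar E (Subtype.val ⁻¹' s) := by
  have h1 : MeasurableSet (Subtype.val ⁻¹' s : Set (Metric.sphere (0 : E) 1)) :=
    measurable_subtype_coe hs
  have h2 : MeasurableSet (Subtype.val ⁻¹' (U ⁻¹' s) : Set (Metric.sphere (0 : E) 1)) :=
    measurable_subtype_coe (U.continuous.measurable hs)
  rw [sphereHaar, Measure.smul_apply, Measure.smul_apply, Measure.toSphere_apply' _ h1,
    Measure.toSphere_apply' _ h2]
  congr 2
  rw [← U.measurePreserving.measure_preimage_emb U.toHomeomorph.measurableEmbedding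
    (Set.Ioo (0 : ℝ) 1 • (Subtype.val '' (Subtype.val ⁻¹' s : Set (Metric.sphere (0 : E) 1))))]
  congr 1
  ext x
  simp only [Set.mem_smul, Set.mem_preimage, Set.mem_image, Subtype.exists]
  constructor
  · rintro ⟨r, hr, y, ⟨a, ha, has, rfl⟩, rfl⟩
    exact ⟨r, hr, U a, ⟨U a, by simpa using ha, has, rfl⟩, by simp⟩
  · rintro ⟨r, hr, y, ⟨a, ha, has, rfl⟩, hx⟩
    refine ⟨r, hr, U.symm a, ⟨U.symm a, by simpa using ha, by simpa using has, rfl⟩, ?_⟩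
    apply U.injective
    simpa using hx

/-- The Haar measure on pure states (unit kets). -/
def haarPure {N : ℕ} (d : Fin N → ℕ) : MeasureTheory.Measure (Metric.sphere (0 : Ket d) 1) :=
  sphereHaar (Ket d)

/-- The Haar measure on pure states with real entries in the computational basis. -/
def haarReal {N : ℕ} (d : Fin N → ℕ) : MeasureTheory.Measure (Metric.sphere (0 : RealKet d) 1) :=
  sphereHaar (RealKet d)

/-- The threshold `log d_T - log (d_S ln d_T) - log c`, where `log` is binary. -/
def threshold {N : ℕ} (d : Fin N → ℕ) (c : ℝ) : ℝ :=
  Real.logb 2 (totalDim d) - Real.logb 2 (sumDim d * Real.log (totalDim d)) - Real.logb 2 c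

/-- The probability bound `exp (-a √d_T + d_S ln (59 N d_T))`. -/
def expBound {N : ℕ} (d : Fin N → ℕ) (a : ℝ) : ℝ :=
  Real.exp (-a * Real.sqrt (totalDim d) + sumDim d * Real.log (59 * N * totalDim d))

end QState

end

/-! Everything is controlled by the overlaps of ψ with product vectors. If |⟨⊗v_j, ψ⟩| ≤ √t ∏‖v_j‖
for all v, then tr(|ψ⟩⟨ψ|σ) ≤ t for every separable σ, and each of G, E_R, R_L is at least -log t
(`le_GM_pureState`, `le_REE_pureState`, `le_LGR_pureState`). All the events therefore lie in the
single event that the overlap bound fails, so the bounds for E_R and R_L cost nothing beyond those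
for G.

That event is estimated by a union bound (`measureReal_exists_overlap_gt_le`). In each factor take a
δ-net of the unit sphere with δ = 1/(8N); the product net has at most (1+16N)^(2 d_S) points.
Replacing net points by arbitrary unit vectors one factor at a time costs 1/(1-δ) per factor, and
(1-δ)^(2N) ≥ 3/4. For a fixed net point, a large real part of the overlap puts ψ in a spherical cap,
whose measure is at most exp(-n r²/2) in real dimension n (`sphereHaar_real_cap_le`). Real parts
suffice because a phase can be moved into one tensor factor.

With n = q d_T, where q = 2 for complex and q = 1 for real kets, the result is (1+16N)^(2 d_S)
exp(-(3/8) q d_T t). Inserting t = (9/q) d_S ln d_T / d_T or t = d_T^(-1/2) gives the two kinds of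
bound, except for small d_T, where the claims are trivial. -/

open scoped ComplexOrder

noncomputable section

/-! ### Spherical caps and nets in real inner product spaces. -/

section Geometry

open MeasureTheory Metric Module
open scoped Pointwise

/-- A cone around `e` lies, within the unit ball, in a ball centred on the axis of the cone. -/
theorem norm_sub_smul_sq_le_of_le_inner {E : Type*} [NormedAddCommGroup E]
    [InnerProductSpace ℝ E] {e x : E} {r c s : ℝ} (he : ‖e‖ ≤ 1) (hc : 0 ≤ c)
    (hx : ‖x‖ = 1) (hr : r ≤ inner ℝ e x) (hs : s ∈ Set.Ioo (0 : ℝ) 1) :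
    ‖s • x - c • e‖ ^ 2 ≤ max (c ^ 2) (1 - 2 * c * r + c ^ 2) := by
  obtain ⟨h0, h1⟩ := hs
  have h : ‖s • x - c • e‖ ^ 2 = s ^ 2 - 2 * (s * c * inner ℝ e x) + c ^ 2 * ‖e‖ ^ 2 := by
    rw [norm_sub_sq_real, real_inner_smul_left, real_inner_smul_right, norm_smul, norm_smul, hx,
      real_inner_comm, mul_pow, Real.norm_eq_abs, Real.norm_eq_abs, sq_abs, mul_pow, sq_abs]
    ring
  have he2 : ‖e‖ ^ 2 ≤ 1 := by
    have := norm_nonneg e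
    nlinarith
  have h2 : s * c * r ≤ s * c * inner ℝ e x := by gcongr
  -- Since s² ≤ s, the bound becomes affine in s, so the larger of the end values at s = 0 and s = 1
  -- dominates.
  have h3 : ‖s • x - c • e‖ ^ 2 ≤ (1 - s) * c ^ 2 + s * (1 - 2 * c * r + c ^ 2) := by
    rw [h]
    nlinarith [mul_nonneg (sq_nonneg c) (sub_nonneg.2 he2), mul_nonneg h0.le (sub_nonneg.2 h1.le)]
  refine h3.trans ?_
  have h4 := le_max_left (c ^ 2) (1 - 2 * c * r + c ^ 2)
  have h5 := le_max_right (c ^ 2) (1 - 2 * c * r + c ^ 2)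
  nlinarith [mul_le_mul_of_nonneg_left h4 (sub_nonneg.2 h1.le),
    mul_le_mul_of_nonneg_left h5 h0.le]

/-- A centre for which the ball around a cone of half-opening `arccos r` is small. -/
theorem exists_cone_center {r : ℝ} (h0 : 0 ≤ r) (h1 : r ≤ 1) :
    ∃ c, 0 ≤ c ∧ max (c ^ 2) (1 - 2 * c * r + c ^ 2) ≤ Real.exp (-r ^ 2) := by
  have hexp : 1 - r ^ 2 ≤ Real.exp (-r ^ 2) := by
    have := Real.add_one_le_exp (-r ^ 2)
    linarith
  rcases le_total (2 * r ^ 2) 1 with h | h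
  -- For c = r the two terms are r² and 1 - r², and the second is the larger.
  · refine ⟨r, h0, max_le ?_ ?_⟩ <;> linarith [sq_nonneg r]
  · have hr : 0 < r := by nlinarith
    have hc : 2 * (1 / (2 * r)) * r = 1 := by field_simp
    -- This c makes both terms equal to 1/(4r²), so that exp(r²) ≤ 4r² remains to be shown.
    refine ⟨1 / (2 * r), by positivity, ?_⟩
    rw [hc, sub_self, zero_add, max_self, div_pow, one_pow, mul_pow, Real.exp_neg, one_div]
    apply inv_anti₀ (Real.exp_pos _)
    -- `exp` is below its chord on `[1/2, 1]`
    have hu : r ^ 2 ≤ 1 := by nlinarith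
    have hconv := convexOn_exp.2 (Set.mem_univ (1 / 2 : ℝ)) (Set.mem_univ (1 : ℝ))
      (by linarith : 0 ≤ 2 - 2 * r ^ 2) (by linarith : 0 ≤ 2 * r ^ 2 - 1) (by ring)
    -- The end values 4 and 2 place the chord below the line u ↦ 4u at u = r².
    have he1 : Real.exp 1 ≤ 4 := by linarith [Real.exp_one_lt_d9]
    have he2 : Real.exp (1 / 2) ≤ 2 := by
      have h3 : Real.exp (1 / 2) ^ 2 = Real.exp 1 := by
        rw [← Real.exp_nat_mul]; norm_num
      nlinarith [Real.exp_pos (1 / 2)]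
    simp only [smul_eq_mul] at hconv
    rw [show (2 - 2 * r ^ 2) * (1 / 2) + (2 * r ^ 2 - 1) * 1 = r ^ 2 by ring] at hconv
    nlinarith [mul_le_mul_of_nonneg_left he2 (by linarith : 0 ≤ 2 - 2 * r ^ 2),
      mul_le_mul_of_nonneg_left he1 (by linarith : 0 ≤ 2 * r ^ 2 - 1)]

variable {E : Type*} [NormedAddCommGroup E] [InnerProductSpace ℝ E] [FiniteDimensional ℝ E]

/-- The measure of a spherical cap. -/
theorem sphereHaar_real_cap_le [MeasurableSpace E] [BorelSpace E] [Nontrivial E] {e : E} {r : ℝ}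
    (he : ‖e‖ ≤ 1) (h0 : 0 ≤ r) :
    (QState.sphereHaar E).real {x | r ≤ inner ℝ e x.1} ≤
      Real.exp (-(finrank ℝ E * r ^ 2 / 2)) := by
  by_cases h1 : r ≤ 1
  swap
  · have : {x : sphere (0 : E) 1 | r ≤ inner ℝ e x.1} = ∅ := by
      ext x
      simp only [Set.mem_ofPred_eq, Set.mem_empty_iff_false, iff_false, not_le]
      have hx : ‖x.1‖ = 1 := by simp
      have := real_inner_le_norm e x.1
      rw [hx, mul_one] at this
      linarith
    rw [this, measureReal_empty]
    positivity
  obtain ⟨c, hc0, hc⟩ := exists_cone_center h0 h1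
  set A : Set (sphere (0 : E) 1) := {x | r ≤ inner ℝ e x.1} with hA
  have hAm : MeasurableSet A := by
    apply measurableSet_le measurable_const
    exact (Continuous.inner continuous_const continuous_subtype_val).measurable
  have hρ : 0 ≤ Real.exp (-r ^ 2 / 2) := (Real.exp_pos _).le
  -- The normalized measure of the cap is the share of the unit ball filled by the cone over it;
  -- that cone fits in a ball of radius exp(-r²/2), whose volume ratio is the n-th power of the
  -- radius.
  have hsub : Set.Ioo (0 : ℝ) 1 • (Subtype.val '' A) ⊆ closedBall (c • e) (Real.exp (-r ^ 2 / 2)) := by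
    rintro _ ⟨s, hs, _, ⟨x, hx, rfl⟩, rfl⟩
    rw [mem_closedBall, dist_eq_norm]
    refine le_of_sq_le_sq ?_ hρ
    rw [← Real.exp_nat_mul, show ((2 : ℕ) : ℝ) * (-r ^ 2 / 2) = -r ^ 2 by push_cast; ring]
    exact (norm_sub_smul_sq_le_of_le_inner he hc0 (by simp) hx hs).trans hc
  have hb0 : (volume : Measure E) (ball 0 1) ≠ 0 := (measure_ball_pos _ _ one_pos).ne'
  have hbt : (volume : Measure E) (ball 0 1) ≠ ⊤ := measure_ball_lt_top.ne
  have hd0 : (finrank ℝ E : ENNReal) ≠ 0 := by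
    exact_mod_cast (finrank_pos (R := ℝ) (M := E)).ne'
  have hdt : (finrank ℝ E : ENNReal) ≠ ⊤ := ENNReal.natCast_ne_top _
  have key : QState.sphereHaar E A ≤ ENNReal.ofReal (Real.exp (-r ^ 2 / 2) ^ finrank ℝ E) := by
    rw [QState.sphereHaar, Measure.smul_apply, Measure.toSphere_apply_univ,
      Measure.toSphere_apply' _ hAm, smul_eq_mul]
    calc _ ≤ (finrank ℝ E * (volume : Measure E) (ball 0 1))⁻¹ * (finrank ℝ E *
          (ENNReal.ofReal (Real.exp (-r ^ 2 / 2) ^ finrank ℝ E) * (volume : Measure E) (ball 0 1))) := by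
          gcongr
          rw [← Measure.addHaar_closedBall _ (c • e) hρ]
          exact measure_mono hsub
      _ = (finrank ℝ E * (volume : Measure E) (ball 0 1))⁻¹ * (finrank ℝ E *
          (volume : Measure E) (ball 0 1)) * ENNReal.ofReal (Real.exp (-r ^ 2 / 2) ^ finrank ℝ E) := by
          ring
      _ = _ := by
          rw [ENNReal.inv_mul_cancel (mul_ne_zero hd0 hb0) (ENNReal.mul_ne_top hdt hbt), one_mul]
  refine (ENNReal.toReal_le_of_le_ofReal (by positivity) key).trans_eq ?_
  rw [← Real.exp_nat_mul]
  congr 1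
  ring

/-- The volume bound for separated sets of unit vectors. -/
theorem card_le_of_separated_of_norm_le_one {δ : ℝ} (hδ : 0 < δ) (s : Finset E)
    (hs : ∀ x ∈ s, ‖x‖ ≤ 1) (hsep : ∀ x ∈ s, ∀ y ∈ s, x ≠ y → δ ≤ ‖x - y‖) :
    (s.card : ℝ) ≤ (1 + 2 / δ) ^ finrank ℝ E := by
  borelize E
  let μ : Measure E := Measure.addHaar
  have hδ2 : 0 < δ / 2 := by positivity
  have hρ : 0 < 1 + δ / 2 := by positivity
  have D : Set.Pairwise (s : Set E) (Function.onFun Disjoint fun c => ball (c : E) (δ / 2)) := by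
    rintro x hx y hy hxy
    apply ball_disjoint_ball
    rw [dist_eq_norm]
    linarith [hsep x hx y hy hxy]
  have hsub : (⋃ c ∈ s, ball (c : E) (δ / 2)) ⊆ ball (0 : E) (1 + δ / 2) := by
    refine Set.iUnion₂_subset fun x hx => ball_subset_ball' ?_
    rw [dist_zero_right]
    linarith [hs x hx]
  have I : (s.card : ENNReal) * ENNReal.ofReal ((δ / 2) ^ finrank ℝ E) * μ (ball 0 1) ≤
      ENNReal.ofReal ((1 + δ / 2) ^ finrank ℝ E) * μ (ball 0 1) := by
    calc _ = μ (⋃ c ∈ s, ball (c : E) (δ / 2)) := by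
          rw [measure_biUnion_finset D fun c _ => measurableSet_ball]
          simp only [μ.addHaar_ball_of_pos _ hδ2, Finset.sum_const, nsmul_eq_mul, mul_assoc]
      _ ≤ μ (ball (0 : E) (1 + δ / 2)) := measure_mono hsub
      _ = _ := μ.addHaar_ball_of_pos _ hρ
  have J := (ENNReal.mul_le_mul_iff_left (measure_ball_pos μ _ zero_lt_one).ne'
    measure_ball_lt_top.ne).1 I
  have K := ENNReal.toReal_le_of_le_ofReal (pow_nonneg hρ.le _) J
  rw [ENNReal.toReal_mul, ENNReal.toReal_natCast,
    ENNReal.toReal_ofReal (pow_nonneg hδ2.le _), ← le_div_iff₀ (by positivity), ← div_pow] at K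
  refine K.trans_eq ?_
  congr 1
  field_simp
  ring

/-- A net of the unit sphere of controlled size. -/
theorem exists_net_sphere (E : Type*) [NormedAddCommGroup E] [InnerProductSpace ℝ E]
    [FiniteDimensional ℝ E] {δ : ℝ} (hδ : 0 < δ) :
    ∃ T : Finset E, (∀ x ∈ T, ‖x‖ = 1) ∧ (∀ x : E, ‖x‖ = 1 → ∃ y ∈ T, ‖x - y‖ ≤ δ) ∧
      (T.card : ℝ) ≤ (1 + 2 / δ) ^ finrank ℝ E := by
  classical
  let P : Finset E → Prop := fun s => (∀ x ∈ s, ‖x‖ = 1) ∧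
    ∀ x ∈ s, ∀ y ∈ s, x ≠ y → δ ≤ ‖x - y‖
  have hP : ∀ s, P s → (s.card : ℝ) ≤ (1 + 2 / δ) ^ finrank ℝ E := fun s hs =>
    card_le_of_separated_of_norm_le_one hδ s (fun x hx => (hs.1 x hx).le) hs.2
  let C : Set ℕ := {k | ∃ s, P s ∧ s.card = k}
  have hne : C.Nonempty := ⟨0, ∅, ⟨by simp, by simp⟩, rfl⟩
  have hbdd : BddAbove C := by
    refine ⟨⌈(1 + 2 / δ) ^ finrank ℝ E⌉₊, ?_⟩
    rintro _ ⟨s, hs, rfl⟩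
    exact_mod_cast (hP s hs).trans (Nat.le_ceil _)
  -- A separated set of maximal cardinality is a net: a point farther than δ from all of it could be
  -- added.
  obtain ⟨T, hT, hcard⟩ := Nat.sSup_mem hne hbdd
  refine ⟨T, hT.1, fun x hx => ?_, hP T hT⟩
  by_contra! h
  have hxT : x ∉ T := fun hxT => by
    have := h x hxT
    rw [sub_self, norm_zero] at this
    linarith
  have hmem : (insert x T).card ∈ C := by
    refine ⟨_, ⟨?_, ?_⟩, rfl⟩
    · intro y hy
      rcases Finset.mem_insert.1 hy with rfl | hy
      exacts [hx, hT.1 y hy]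
    · intro y hy z hz hyz
      rcases Finset.mem_insert.1 hy with hy | hy <;> rcases Finset.mem_insert.1 hz with hz | hz
      · exact absurd (hy.trans hz.symm) hyz
      · exact hy ▸ (h z hz).le
      · rw [norm_sub_rev]; exact hz ▸ (h y hy).le
      · exact hT.2 y hy z hz hyz
  have := le_csSup hbdd hmem
  rw [Finset.card_insert_of_notMem hxT, ← hcard] at this
  omega

/-- A linear functional is controlled by its values on a net of the unit sphere. -/
theorem linear_le_of_le_on_net {T : Finset E} {δ R : ℝ} (hδ : δ < 1) (hR : 0 ≤ R)
    (hT : ∀ x : E, ‖x‖ = 1 → ∃ y ∈ T, ‖x - y‖ ≤ δ) (g : E →ₗ[ℝ] ℝ)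
    (hg : ∀ y ∈ T, g y ≤ R) {x : E} (hx : ‖x‖ = 1) : g x ≤ R / (1 - δ) := by
  let y := (InnerProductSpace.toDual ℝ E).symm (LinearMap.toContinuousLinearMap g)
  have hy : ∀ z, g z = inner ℝ y z := fun z => by
    simp [y, InnerProductSpace.toDual_symm_apply]
  have hδ' : 0 < 1 - δ := by linarith
  have hxy : g x ≤ ‖y‖ := by
    rw [hy]
    simpa [hx] using real_inner_le_norm y x
  refine hxy.trans ?_
  by_cases h0 : y = 0
  · rw [h0, norm_zero]
    positivity
  have hn : 0 < ‖y‖ := norm_pos_iff.2 h0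
  -- Test at a net point near the maximizer of g on the sphere: there g is at least (1-δ)‖y‖.
  obtain ⟨w, hw, hd⟩ := hT (‖y‖⁻¹ • y) (by
    rw [norm_smul, norm_inv, norm_norm, inv_mul_cancel₀ hn.ne'])
  have h1 := hg w hw
  have h2 : inner ℝ y (‖y‖⁻¹ • y - w) ≤ ‖y‖ * δ :=
    (real_inner_le_norm _ _).trans (by gcongr)
  rw [inner_sub_right, real_inner_smul_right, real_inner_self_eq_norm_sq, ← hy w, sq,
    ← mul_assoc, inv_mul_cancel₀ hn.ne', one_mul] at h2
  rw [le_div_iff₀ hδ']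
  linarith

end Geometry

/-! ### Overlaps with product vectors: from nets to arbitrary vectors. -/

namespace QState

variable {N : ℕ} {d : Fin N → ℕ}

/-- The product vector `⨂ⱼ (v j)`. -/
def prodKet (v : (j : Fin N) → EuclideanSpace ℂ (Fin (d j))) : Ket d :=
  WithLp.toLp 2 fun i => ∏ j, v j (i j)

/-- The overlap `⟨⨂ⱼ (v j), ψ⟩`. -/
def overlap (ψ : Ket d) (v : (j : Fin N) → EuclideanSpace ℂ (Fin (d j))) : ℂ :=
  inner ℂ (prodKet v) ψ

theorem overlap_eq_sum (ψ : Ket d) (v : (j : Fin N) → EuclideanSpace ℂ (Fin (d j))) :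
    overlap ψ v = ∑ i, (∏ j, star (v j (i j))) * ψ i := by
  simp [overlap, prodKet, PiLp.inner_apply, mul_comm]

theorem norm_prodKet (v : (j : Fin N) → EuclideanSpace ℂ (Fin (d j))) :
    ‖prodKet v‖ = ∏ j, ‖v j‖ := by
  have h : ‖prodKet v‖ ^ 2 = (∏ j, ‖v j‖) ^ 2 := by
    rw [EuclideanSpace.norm_sq_eq, ← Finset.prod_pow]
    simp_rw [EuclideanSpace.norm_sq_eq, prodKet, norm_prod, ← Finset.prod_pow]
    rw [Finset.prod_univ_sum, Fintype.piFinset_univ]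
  exact (sq_eq_sq₀ (norm_nonneg _) (Finset.prod_nonneg fun _ _ => norm_nonneg _)).1 h

theorem overlap_smul (ψ : Ket d) (c : Fin N → ℂ)
    (v : (j : Fin N) → EuclideanSpace ℂ (Fin (d j))) :
    overlap ψ (fun j => c j • v j) = (∏ j, star (c j)) * overlap ψ v := by
  simp only [overlap_eq_sum, Finset.mul_sum, PiLp.smul_apply, smul_eq_mul, star_mul',
    Finset.prod_mul_distrib, mul_assoc]

theorem overlap_update (ψ : Ket d) (v : (j : Fin N) → EuclideanSpace ℂ (Fin (d j))) (k : Fin N)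
    (x : EuclideanSpace ℂ (Fin (d k))) :
    overlap ψ (Function.update v k x) =
      ∑ i, star (x (i k)) * ((∏ j ∈ Finset.univ.erase k, star (v j (i j))) * ψ i) := by
  rw [overlap_eq_sum]
  refine Finset.sum_congr rfl fun i _ => ?_
  rw [← Finset.mul_prod_erase _ _ (Finset.mem_univ k), Function.update_self, mul_assoc]
  congr 2
  refine Finset.prod_congr rfl fun j hj => ?_
  rw [Function.update_of_ne (Finset.ne_of_mem_erase hj)]

/-- The real part of the overlap, as a real linear functional of one tensor factor. -/
def overlapRe (ψ : Ket d) (v : (j : Fin N) → EuclideanSpace ℂ (Fin (d j))) (k : Fin N) :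
    EuclideanSpace ℂ (Fin (d k)) →ₗ[ℝ] ℝ where
  toFun x := (overlap ψ (Function.update v k x)).re
  map_add' x y := by
    simp only [overlap_update, PiLp.add_apply, star_add, add_mul, Finset.sum_add_distrib,
      Complex.add_re]
  map_smul' c x := by
    simp only [overlap_update, PiLp.smul_apply, RingHom.id_apply, smul_eq_mul, star_smul,
      star_trivial, smul_mul_assoc, Complex.re_sum, Complex.smul_re, Finset.mul_sum]

variable {T : (j : Fin N) → Finset (EuclideanSpace ℂ (Fin (d j)))} {δ r : ℝ} {ψ : Ket d}

/-- From nets to unit vectors, one tensor factor at a time. -/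
theorem overlap_re_le_of_net (h0 : 0 ≤ r) (hδ : δ < 1)
    (hT : ∀ j, ∀ x : EuclideanSpace ℂ (Fin (d j)), ‖x‖ = 1 → ∃ y ∈ T j, ‖x - y‖ ≤ δ)
    (hr : ∀ w : (j : Fin N) → EuclideanSpace ℂ (Fin (d j)), (∀ j, w j ∈ T j) →
      (overlap ψ w).re ≤ r)
    (s : Finset (Fin N)) : ∀ v : (j : Fin N) → EuclideanSpace ℂ (Fin (d j)),
      (∀ j ∈ s, ‖v j‖ = 1) → (∀ j ∉ s, v j ∈ T j) →
      (overlap ψ v).re ≤ r / (1 - δ) ^ s.card := by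
  have hδ' : 0 < 1 - δ := by linarith
  induction s using Finset.induction_on with
  | empty => intro v _ hv; simpa using hr v fun j => hv j (Finset.notMem_empty j)
  | insert k s hk ih =>
    intro v hv1 hv2
    -- With y from the net in slot k, only the factors in `s` are off the nets, so the induction
    -- hypothesis applies.
    have hg : ∀ y ∈ T k, overlapRe ψ v k y ≤ r / (1 - δ) ^ s.card := by
      intro y hy
      refine ih _ (fun j hj => ?_) (fun j hj => ?_)
      · rw [Function.update_of_ne (ne_of_mem_of_not_mem hj hk)]
        exact hv1 j (Finset.mem_insert_of_mem hj)
      · by_cases hjk : j = k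
        · subst hjk
          rwa [Function.update_self]
        · rw [Function.update_of_ne hjk]
          exact hv2 j (by simp [hjk, hj])
    have h := linear_le_of_le_on_net hδ (by positivity) (hT k) _ hg
      (hv1 k (Finset.mem_insert_self k s))
    rw [div_div, ← pow_succ, ← Finset.card_insert_of_notMem hk] at h
    simpa [overlapRe] using h

/-- The overlap is conjugate-homogeneous in each factor. Normalizing the factors and rotating one of
them by the phase of the overlap turns the real part into the modulus; `NeZero N` supplies that
factor. -/
theorem norm_overlap_le_of_net [NeZero N] (h0 : 0 ≤ r) (hδ : δ < 1)
    (hT : ∀ j, ∀ x : EuclideanSpace ℂ (Fin (d j)), ‖x‖ = 1 → ∃ y ∈ T j, ‖x - y‖ ≤ δ)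
    (hr : ∀ w : (j : Fin N) → EuclideanSpace ℂ (Fin (d j)), (∀ j, w j ∈ T j) →
      (overlap ψ w).re ≤ r)
    (v : (j : Fin N) → EuclideanSpace ℂ (Fin (d j))) :
    ‖overlap ψ v‖ ≤ r / (1 - δ) ^ N * ∏ j, ‖v j‖ := by
  have hδ' : 0 < 1 - δ := by linarith
  have hunit : ∀ u : (j : Fin N) → EuclideanSpace ℂ (Fin (d j)), (∀ j, ‖u j‖ = 1) →
      (overlap ψ u).re ≤ r / (1 - δ) ^ N := fun u hu => by
    simpa using overlap_re_le_of_net h0 hδ hT hr Finset.univ u (fun j _ => hu j) (by simp)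
  by_cases hv : ∃ j, v j = 0
  · obtain ⟨k, hk⟩ := hv
    have : overlap ψ v = 0 := by
      rw [← Function.update_eq_self k v, hk, overlap_update]
      simp
    rw [this, norm_zero]
    positivity
  push Not at hv
  have hn : ∀ j, ‖v j‖ ≠ 0 := fun j => norm_ne_zero_iff.2 (hv j)
  by_cases hz : overlap ψ v = 0
  · rw [hz, norm_zero]
    positivity
  set z := overlap ψ v with hzdef
  have hzn : ‖z‖ ≠ 0 := norm_ne_zero_iff.2 hz
  let c : Fin N → ℂ := fun j => (if j = 0 then z / ‖z‖ else 1) * ((‖v j‖⁻¹ : ℝ) : ℂ)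
  have hc : (∏ j, star (c j)) = star z / ‖z‖ * ((∏ j, ‖v j‖)⁻¹ : ℝ) := by
    simp only [c, star_mul', Finset.prod_mul_distrib]
    congr 1
    · rw [Finset.prod_eq_single 0]
      · simp
      · intro j _ hj; simp [hj]
      · simp
    · simp [Finset.prod_inv_distrib]
  have hu := hunit (fun j => c j • v j) fun j => by
    rw [norm_smul, norm_mul, Complex.norm_real, norm_inv, norm_norm, mul_assoc,
      inv_mul_cancel₀ (hn j), mul_one]
    split_ifs
    · rw [norm_div, Complex.norm_real, norm_norm, div_self hzn]
    · exact norm_one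
  rw [overlap_smul, hc, ← hzdef] at hu
  have hre : star z / ‖z‖ * ((∏ j, ‖v j‖)⁻¹ : ℝ) * z = ((‖z‖ * (∏ j, ‖v j‖)⁻¹ : ℝ) : ℂ) := by
    have h1 : star z * z = (‖z‖ : ℂ) ^ 2 := Complex.conj_mul' z
    have h2 : (‖z‖ : ℂ) ≠ 0 := by exact_mod_cast hzn
    calc _ = star z * z / ‖z‖ * ((∏ j, ‖v j‖)⁻¹ : ℝ) := by ring
      _ = _ := by
        rw [h1, sq, mul_div_assoc, div_self h2, mul_one]
        push_cast
        rfl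
  rw [hre, Complex.ofReal_re] at hu
  have hp : 0 < ∏ j, ‖v j‖ := Finset.prod_pos fun j _ => norm_pos_iff.2 (hv j)
  rwa [← div_eq_mul_inv, div_le_iff₀ hp] at hu

end QState

/-! ### Separable states, geometric measure and robustness. -/

namespace QState

open Matrix

/-- The expectation value of `σ` in a pure state. -/
theorem trace_pureState_mul {n : Type*} [Fintype n] (ψ : EuclideanSpace ℂ n) (σ : Matrix n n ℂ) :
    (pureState ψ * σ).trace = star (ψ : n → ℂ) ⬝ᵥ σ *ᵥ (ψ : n → ℂ) := by
  simp only [trace, diag, mul_apply, pureState, of_apply, dotProduct, mulVec, Pi.star_apply,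
    Finset.mul_sum]
  rw [Finset.sum_comm]
  refine Finset.sum_congr rfl fun i _ => Finset.sum_congr rfl fun k _ => ?_
  ring

theorem posSemidef_iff_exists_eq_conjTranspose_mul_self {n : Type*} [Fintype n]
    {σ : Matrix n n ℂ} : σ.PosSemidef ↔ ∃ B : Matrix n n ℂ, σ = Bᴴ * B := by
  classical
  constructor
  · intro h
    open scoped MatrixOrder in
    exact CStarAlgebra.nonneg_iff_eq_star_mul_self.mp h.nonneg
  · rintro ⟨B, rfl⟩
    exact posSemidef_conjTranspose_mul_self B

variable {N : ℕ} {d : Fin N → ℕ}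

theorem tensor_conjTranspose_mul_self (B : (j : Fin N) → Matrix (Fin (d j)) (Fin (d j)) ℂ) :
    tensor (fun j => (B j)ᴴ * B j) = (tensor B)ᴴ * tensor B := by
  ext i k
  simp only [tensor, of_apply, mul_apply, conjTranspose_apply, star_prod, ← Finset.prod_mul_distrib]
  rw [Finset.prod_univ_sum, Fintype.piFinset_univ]

theorem tensor_mulVec_eq_overlap (B : (j : Fin N) → Matrix (Fin (d j)) (Fin (d j)) ℂ)
    (ψ : Ket d) (m : Idx d) :
    (tensor B *ᵥ (ψ : Idx d → ℂ)) m =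
      overlap ψ fun j => WithLp.toLp 2 fun a => star (B j (m j) a) := by
  simp [overlap_eq_sum, mulVec, dotProduct, tensor]

theorem re_trace_pureState_mul_conjTranspose_mul_self {n : Type*} [Fintype n]
    (ψ : EuclideanSpace ℂ n) (A : Matrix n n ℂ) :
    (pureState ψ * (Aᴴ * A)).trace.re = ∑ m, ‖(A *ᵥ (ψ : n → ℂ)) m‖ ^ 2 := by
  rw [trace_pureState_mul, ← mulVec_mulVec, dotProduct_mulVec, ← star_mulVec, dotProduct,
    Complex.re_sum]
  refine Finset.sum_congr rfl fun m _ => ?_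
  rw [Pi.star_apply]
  have := Complex.conj_mul' ((A *ᵥ (ψ : n → ℂ)) m)
  rw [Complex.star_def, this]
  norm_cast

theorem trace_conjTranspose_mul_self_re {n : Type*} [Fintype n] (B : Matrix n n ℂ) :
    (Bᴴ * B).trace = ((∑ m, ‖(WithLp.toLp 2 fun a => star (B m a) : EuclideanSpace ℂ n)‖ ^ 2 : ℝ) : ℂ) := by
  simp only [EuclideanSpace.norm_sq_eq, trace, diag, mul_apply, conjTranspose_apply]
  rw [Finset.sum_comm]
  push_cast
  refine Finset.sum_congr rfl fun m _ => Finset.sum_congr rfl fun a _ => ?_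
  rw [norm_star]
  exact Complex.conj_mul' _

/-- Writing σ_j = B_j†B_j, the trace is a sum of squared overlaps of ψ with product vectors built
from the conjugated rows of the B_j. The squared norms of these product vectors sum to ∏ tr σ_j = 1,
so no spectral decomposition is needed. -/
theorem re_trace_pureState_mul_tensor_le {ψ : Ket d} {m : ℝ}
    (H : ∀ v, ‖overlap ψ v‖ ≤ m * ∏ j, ‖v j‖)
    {σ : (j : Fin N) → Matrix (Fin (d j)) (Fin (d j)) ℂ} (hσ : ∀ j, IsState (σ j)) :
    (pureState ψ * tensor σ).trace.re ≤ m ^ 2 := by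
  choose B hB using fun j => posSemidef_iff_exists_eq_conjTranspose_mul_self.1 (hσ j).1
  obtain rfl : σ = fun j => (B j)ᴴ * B j := funext hB
  have htr : ∀ j, ∑ k, ‖(WithLp.toLp 2 fun a => star (B j k a) :
      EuclideanSpace ℂ (Fin (d j)))‖ ^ 2 = 1 := fun j => by
    have := (hσ j).2
    rw [trace_conjTranspose_mul_self_re] at this
    exact_mod_cast this
  rw [tensor_conjTranspose_mul_self, re_trace_pureState_mul_conjTranspose_mul_self]
  calc _ ≤ ∑ i : Idx d, m ^ 2 * ∏ j, ‖(WithLp.toLp 2 fun a => star (B j (i j) a) :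
          EuclideanSpace ℂ (Fin (d j)))‖ ^ 2 := by
        refine Finset.sum_le_sum fun i _ => ?_
        rw [tensor_mulVec_eq_overlap, Finset.prod_pow, ← mul_pow]
        exact pow_le_pow_left₀ (norm_nonneg _) (H _) 2
    _ = m ^ 2 * ∏ j, ∑ k, ‖(WithLp.toLp 2 fun a => star (B j k a) :
          EuclideanSpace ℂ (Fin (d j)))‖ ^ 2 := by
        rw [Finset.prod_univ_sum, Fintype.piFinset_univ, Finset.mul_sum]
    _ = m ^ 2 := by rw [Finset.prod_congr rfl fun j _ => htr j, Finset.prod_const_one, mul_one]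

theorem re_trace_pureState_mul_le {ψ : Ket d} {m : ℝ}
    (H : ∀ v, ‖overlap ψ v‖ ≤ m * ∏ j, ‖v j‖) {σ : Matrix (Idx d) (Idx d) ℂ} (hσ : σ ∈ SEP d) :
    (pureState ψ * σ).trace.re ≤ m ^ 2 := by
  let L : Matrix (Idx d) (Idx d) ℂ →ₗ[ℝ] ℝ :=
    { toFun := fun σ => (pureState ψ * σ).trace.re
      map_add' := fun a b => by simp [mul_add]
      map_smul' := fun c a => by simp }
  have hconv : Convex ℝ {σ | L σ ≤ m ^ 2} := convex_halfSpace_le L.isLinear _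
  refine convexHull_min ?_ hconv hσ
  rintro _ ⟨τ, hτ, rfl⟩
  exact re_trace_pureState_mul_tensor_le H hτ

theorem posSemidef_tensor {σ : (j : Fin N) → Matrix (Fin (d j)) (Fin (d j)) ℂ}
    (hσ : ∀ j, (σ j).PosSemidef) : (tensor σ).PosSemidef := by
  choose B hB using fun j => posSemidef_iff_exists_eq_conjTranspose_mul_self.1 (hσ j)
  obtain rfl : σ = fun j => (B j)ᴴ * B j := funext hB
  rw [tensor_conjTranspose_mul_self]
  exact posSemidef_conjTranspose_mul_self _

theorem posSemidef_of_mem_SEP {σ : Matrix (Idx d) (Idx d) ℂ} (hσ : σ ∈ SEP d) :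
    σ.PosSemidef := by
  have hconv : Convex ℝ {σ : Matrix (Idx d) (Idx d) ℂ | σ.PosSemidef} := by
    intro a ha b hb s t hs ht _
    exact (PosSemidef.smul ha hs).add (PosSemidef.smul hb ht)
  refine convexHull_min ?_ hconv hσ
  rintro _ ⟨τ, hτ, rfl⟩
  exact posSemidef_tensor fun j => (hτ j).1

theorem isState_single {n : Type*} [Fintype n] [DecidableEq n] (a : n) :
    IsState (single a a (1 : ℂ)) := by
  refine ⟨posSemidef_iff_exists_eq_conjTranspose_mul_self.2 ⟨single a a 1, by simp⟩, by simp⟩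

theorem tensor_single_mem_SEP (i : Idx d) :
    tensor (fun j => single (i j) (i j) (1 : ℂ)) ∈ SEP d :=
  subset_convexHull _ _ ⟨_, fun j => isState_single (i j), rfl⟩

theorem tensor_single (i : Idx d) :
    tensor (fun j => single (i j) (i j) (1 : ℂ)) = single i i 1 := by
  ext k l
  simp only [tensor, of_apply, single_apply]
  by_cases h : i = k ∧ i = l
  · obtain ⟨rfl, rfl⟩ := h
    simp
  · rw [if_neg h]
    obtain ⟨j, hj⟩ : ∃ j, ¬ (i j = k j ∧ i j = l j) := by
      by_contra! h'
      exact h ⟨funext fun j => (h' j).1, funext fun j => (h' j).2⟩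
    exact Finset.prod_eq_zero (Finset.mem_univ j) (if_neg hj)

theorem single_mem_SEP (i : Idx d) : single i i (1 : ℂ) ∈ SEP d :=
  tensor_single i ▸ tensor_single_mem_SEP i

theorem re_trace_pureState_mul_single (ψ : Ket d) (i : Idx d) :
    (pureState ψ * single i i (1 : ℂ)).trace.re = ‖ψ i‖ ^ 2 := by
  rw [trace_mul_single, op_smul_eq_mul, pureState, of_apply, mul_one, Complex.star_def,
    Complex.mul_conj']
  norm_cast

theorem pureState_mul_self {n : Type*} [Fintype n] {ψ : EuclideanSpace ℂ n} (hψ : ‖ψ‖ = 1) :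
    pureState ψ * pureState ψ = pureState ψ := by
  have h : ∑ k, star (ψ k) * ψ k = 1 := by
    have h1 : ‖ψ‖ ^ 2 = 1 := by rw [hψ, one_pow]
    rw [EuclideanSpace.norm_sq_eq] at h1
    have h2 : ((∑ k, ‖ψ k‖ ^ 2 : ℝ) : ℂ) = 1 := by rw [h1]; norm_num
    rw [← h2]
    push_cast
    exact Finset.sum_congr rfl fun k _ => Complex.conj_mul' _
  ext i k
  simp only [mul_apply, pureState, of_apply]
  calc _ = ψ i * (∑ k, star (ψ k) * ψ k) * star (ψ k) := by
        rw [Finset.mul_sum, Finset.sum_mul]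
        exact Finset.sum_congr rfl fun l _ => by ring
    _ = _ := by rw [h, mul_one]

theorem isHermitian_pureState {n : Type*} (ψ : EuclideanSpace ℂ n) :
    (pureState ψ).IsHermitian := by
  ext i k
  simp [pureState, mul_comm]

theorem isState_pureState {n : Type*} [Fintype n] {ψ : EuclideanSpace ℂ n} (hψ : ‖ψ‖ = 1) :
    IsState (pureState ψ) := by
  refine ⟨posSemidef_iff_exists_eq_conjTranspose_mul_self.2 ⟨pureState ψ, ?_⟩, ?_⟩
  · rw [(isHermitian_pureState ψ).eq, pureState_mul_self hψ]
  · have h1 : ‖ψ‖ ^ 2 = 1 := by rw [hψ, one_pow]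
    rw [EuclideanSpace.norm_sq_eq] at h1
    have h2 : ((∑ k, ‖ψ k‖ ^ 2 : ℝ) : ℂ) = 1 := by rw [h1]; norm_num
    rw [← h2]
    push_cast
    exact Finset.sum_congr rfl fun k _ => Complex.mul_conj' _

/-- A bound on the overlaps with product vectors bounds the geometric measure. -/
theorem le_GM_pureState {ψ : Ket d} (hψ : ‖ψ‖ = 1) {m : ℝ}
    (H : ∀ v, ‖overlap ψ v‖ ≤ m * ∏ j, ‖v j‖) :
    -Real.logb 2 (m ^ 2) ≤ GM (pureState ψ) := by
  set X := (fun σ => (pureState ψ * σ).trace.re) '' SEP d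
  have hub : ∀ x ∈ X, x ≤ m ^ 2 := by
    rintro _ ⟨σ, hσ, rfl⟩
    exact re_trace_pureState_mul_le H hσ
  obtain ⟨i, hi⟩ : ∃ i, ψ i ≠ 0 := by
    by_contra! h
    have : ψ = 0 := by ext i; simp [h]
    rw [this, norm_zero] at hψ
    exact zero_ne_one hψ
  -- As `Real.logb 2 0 = 0`, monotonicity of the logarithm needs a positive supremum; a basis
  -- product state on which ψ has a nonzero entry gives it.
  have hpos : 0 < sSup X := by
    have h1 : ‖ψ i‖ ^ 2 ≤ sSup X := le_csSup ⟨_, hub⟩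
      ⟨_, single_mem_SEP i, re_trace_pureState_mul_single ψ i⟩
    have := norm_pos_iff.2 hi
    exact lt_of_lt_of_le (by positivity) h1
  have hle : sSup X ≤ m ^ 2 := Real.sSup_le hub (sq_nonneg m)
  have hGM : GM (pureState ψ) = -Real.logb 2 (sSup X) := by
    rw [GM, maxOverlap, Real.sqrt_eq_rpow, Real.logb_rpow_eq_mul_logb_of_pos hpos]
    ring
  rw [hGM]
  exact neg_le_neg (Real.logb_le_logb_of_le one_lt_two hpos hle)

/-- The maximally mixed state. -/
theorem smul_one_mem_SEP (hd : ∀ j, 0 < d j) :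
    ((totalDim d : ℝ)⁻¹ • (1 : Matrix (Idx d) (Idx d) ℂ)) ∈ SEP d := by
  refine subset_convexHull _ _ ⟨fun j => ((d j : ℝ)⁻¹) • 1, fun j => ⟨?_, ?_⟩, ?_⟩
  · exact PosSemidef.one.smul (by positivity)
  · have : (d j : ℂ) ≠ 0 := by exact_mod_cast (hd j).ne'
    simp [trace_smul, this]
  · ext i k
    simp only [tensor, of_apply, Matrix.smul_apply, one_apply, totalDim]
    by_cases h : i = k
    · subst h
      simp [Finset.prod_inv_distrib]
    · rw [if_neg h, smul_zero]
      obtain ⟨j, hj⟩ := Function.ne_iff.1 h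
      exact (Finset.prod_eq_zero (Finset.mem_univ j) (by simp [hj])).symm

theorem card_Idx : Fintype.card (Idx d) = totalDim d := by
  simp [totalDim]

/-- Mixing ψ with the normalized projection onto its orthogonal complement, at t = d_T - 1, yields
the maximally mixed state. Without such a t the infimum defining `GR` would take the default value
0. -/
theorem GR_set_nonempty (hd : ∀ j, 0 < d j) (hD : 2 ≤ totalDim d) {ψ : Ket d} (hψ : ‖ψ‖ = 1) :
    {t : ℝ | 0 ≤ t ∧ ∃ Δ : Matrix (Idx d) (Idx d) ℂ,
      IsState Δ ∧ (1 + t)⁻¹ • (pureState ψ + t • Δ) ∈ SEP d}.Nonempty := by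
  have hD' : (2 : ℝ) ≤ totalDim d := by exact_mod_cast hD
  have h1 : (totalDim d : ℝ) - 1 ≠ 0 := by linarith
  have h1' : (totalDim d : ℂ) - 1 ≠ 0 := by exact_mod_cast h1
  refine ⟨totalDim d - 1, by linarith, ((totalDim d : ℝ) - 1)⁻¹ • (1 - pureState ψ),
    ⟨?_, ?_⟩, ?_⟩
  · refine PosSemidef.smul ?_ (inv_nonneg.2 (by linarith))
    refine posSemidef_iff_exists_eq_conjTranspose_mul_self.2 ⟨1 - pureState ψ, ?_⟩
    rw [conjTranspose_sub, conjTranspose_one, (isHermitian_pureState ψ).eq, sub_mul, one_mul,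
      mul_sub, mul_one, pureState_mul_self hψ, sub_self, sub_zero]
  · rw [trace_smul, trace_sub, trace_one, card_Idx, (isState_pureState hψ).2, Complex.real_smul]
    push_cast
    exact inv_mul_cancel₀ h1'
  · rw [smul_smul, mul_inv_cancel₀ h1, one_smul, add_sub_cancel, add_sub_cancel]
    exact smul_one_mem_SEP hd

/-- A bound on the overlaps with product vectors bounds the robustness. -/
theorem le_LGR_pureState (hd : ∀ j, 0 < d j) (hD : 2 ≤ totalDim d) {ψ : Ket d} (hψ : ‖ψ‖ = 1)
    {m : ℝ} (hm : 0 < m) (H : ∀ v, ‖overlap ψ v‖ ≤ m * ∏ j, ‖v j‖) :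
    -Real.logb 2 (m ^ 2) ≤ LGR (pureState ψ) := by
  have hm2 : 0 < m ^ 2 := by positivity
  have hGR : (m ^ 2)⁻¹ - 1 ≤ GR (pureState ψ) := by
    refine le_csInf (GR_set_nonempty hd hD hψ) ?_
    rintro t ⟨ht, Δ, hΔ, hS⟩
    have ht1 : 0 < 1 + t := by linarith
    have h1 := re_trace_pureState_mul_le H hS
    have h2 : 0 ≤ (pureState ψ * Δ).trace.re := by
      obtain ⟨B, rfl⟩ := posSemidef_iff_exists_eq_conjTranspose_mul_self.1 hΔ.1
      rw [re_trace_pureState_mul_conjTranspose_mul_self]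
      positivity
    rw [mul_smul_comm, mul_add, mul_smul_comm, pureState_mul_self hψ, trace_smul, trace_add,
      trace_smul, (isState_pureState hψ).2, Complex.smul_re, Complex.add_re, Complex.smul_re,
      Complex.one_re, smul_eq_mul, smul_eq_mul] at h1
    -- The ψ-component alone contributes 1/(1+t) to the overlap of ψ with the separable mixture; Δ
    -- contributes a nonnegative amount.
    have h3 : (1 + t)⁻¹ ≤ m ^ 2 := by
      refine le_trans ?_ h1
      have : 0 < (1 + t)⁻¹ := by positivity
      nlinarith [mul_nonneg this.le (mul_nonneg ht h2)]
    have h4 := inv_anti₀ (by positivity) h3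
    rw [inv_inv] at h4
    linarith
  rw [LGR, ← Real.logb_inv]
  exact Real.logb_le_logb_of_le one_lt_two (by positivity) (by linarith)

end QState

/-! ### Relative entropy of entanglement. -/

namespace QState

open Matrix

/-- The spectral distribution of a Hermitian matrix in a pure state. -/
theorem re_trace_pureState_mul_cfc {n : Type*} [Fintype n] [DecidableEq n]
    (ψ : EuclideanSpace ℂ n) {σ : Matrix n n ℂ} (hσ : σ.IsHermitian) (f : ℝ → ℝ) :
    (pureState ψ * cfc f σ).trace.re = ∑ k, f (hσ.eigenvalues k) *
      ‖((hσ.eigenvectorUnitary : Matrix n n ℂ)ᴴ *ᵥ (ψ : n → ℂ)) k‖ ^ 2 := by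
  rw [hσ.cfc_eq, IsHermitian.cfc, Unitary.conjStarAlgAut_apply, trace_pureState_mul,
    star_eq_conjTranspose, ← mulVec_mulVec, ← mulVec_mulVec, dotProduct_mulVec,
    ← conjTranspose_conjTranspose (hσ.eigenvectorUnitary : Matrix n n ℂ), ← star_mulVec,
    conjTranspose_conjTranspose, dotProduct, Complex.re_sum]
  refine Finset.sum_congr rfl fun k _ => ?_
  rw [Pi.star_apply, mulVec_diagonal, mul_left_comm, Complex.star_def, Complex.conj_mul']
  rw [← Complex.ofReal_pow]
  exact (Complex.re_ofReal_mul _ _).trans (by rw [Complex.ofReal_re]; rfl)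

/-- A projection has spectrum in {0, 1}, where `Real.logb 2` vanishes (at 0 by convention). Hence
only the term in log σ survives in the relative entropy. -/
theorem cfc_logb_pureState {n : Type*} [Fintype n] [DecidableEq n] {ψ : EuclideanSpace ℂ n}
    (hψ : ‖ψ‖ = 1) : cfc (Real.logb 2) (pureState ψ) = 0 := by
  rw [← cfc_const_zero ℝ (pureState ψ)]
  apply cfc_congr
  intro x hx
  rcases IsIdempotentElem.spectrum_subset ℝ (pureState_mul_self hψ) hx with h | h
  · simp [h]
  · simp [Set.mem_singleton_iff.1 h]

/-- `⟨ψ|log σ|ψ⟩ ≤ log ⟨ψ|σ|ψ⟩` when `ψ` lies in the support of `σ`. -/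
theorem re_trace_pureState_mul_cfc_logb_le {n : Type*} [Fintype n] [DecidableEq n]
    {ψ : EuclideanSpace ℂ n} (hψ : ‖ψ‖ = 1) {σ : Matrix n n ℂ} (hσ : σ.PosSemidef)
    (hsupp : ∀ v : n → ℂ, σ *ᵥ v = 0 → pureState ψ *ᵥ v = 0) {a : ℝ} (ha : 0 < a)
    (hle : (pureState ψ * σ).trace.re ≤ a) :
    (pureState ψ * cfc (Real.logb 2) σ).trace.re ≤ Real.logb 2 a := by
  have hsa : IsSelfAdjoint σ := hσ.isHermitian
  set p : n → ℝ := fun k =>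
    ‖((hσ.isHermitian.eigenvectorUnitary : Matrix n n ℂ)ᴴ *ᵥ (ψ : n → ℂ)) k‖ ^ 2 with hp
  set lam := hσ.isHermitian.eigenvalues with hlam
  have hp0 : ∀ k, 0 ≤ p k := fun k => sq_nonneg _
  have hl0 : ∀ k, 0 ≤ lam k := fun k => hσ.eigenvalues_nonneg k
  have key := re_trace_pureState_mul_cfc ψ hσ.isHermitian
  have h1 : ∑ k, p k = 1 := by
    have := key fun _ => 1
    rw [cfc_const_one ℝ σ, mul_one, (isState_pureState hψ).2, Complex.one_re] at this
    rw [this]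
    exact Finset.sum_congr rfl fun k _ => (one_mul _).symm
  have h2 : ∑ k, lam k * p k ≤ a := by
    have := key fun x => x
    rw [cfc_id' ℝ σ] at this
    rwa [this] at hle
  -- The convention `Real.logb 2 0 = 0` would spoil the inequality if ψ had weight on the kernel of
  -- σ. The functional calculus of the indicator of 0 is the kernel projection, which the support
  -- hypothesis forces |ψ⟩⟨ψ| to annihilate.
  have h3 : ∀ k, lam k = 0 → p k = 0 := by
    let f : ℝ → ℝ := fun x => if x = 0 then 1 else 0
    have hf : ContinuousOn f (spectrum ℝ σ) := σ.finite_real_spectrum.continuousOn f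
    have hmul : σ * cfc f σ = 0 := by
      have := cfc_mul (fun x => x) f σ continuousOn_id hf
      rw [cfc_id' ℝ σ] at this
      rw [← this, ← cfc_const_zero ℝ σ]
      congr 1
      ext x
      by_cases hx : x = 0 <;> simp [f, hx]
    have hzero : pureState ψ * cfc f σ = 0 := by
      ext i k
      have hk : σ *ᵥ (cfc f σ).col k = 0 := by
        ext l
        exact congrFun (congrFun hmul l) k
      exact congrFun (hsupp _ hk) i
    have hsum := key f
    rw [hzero, trace_zero, Complex.zero_re] at hsum
    intro k hk
    have h0 := (Finset.sum_eq_zero_iff_of_nonneg fun k _ => mul_nonneg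
      (by simp only [f]; split_ifs <;> norm_num) (hp0 k)).1 hsum.symm k (Finset.mem_univ k)
    have hfk : f (lam k) = 1 := if_pos hk
    rwa [hfk, one_mul] at h0
  have hln : 0 < Real.log 2 := Real.log_pos one_lt_two
  rw [key]
  -- Jensen's inequality through the tangent line of the logarithm at a, which also allows a to
  -- exceed the mean.
  calc _ ≤ ∑ k, (Real.logb 2 a * p k + (lam k * p k / a - p k) / Real.log 2) := by
        refine Finset.sum_le_sum fun k _ => ?_
        change Real.logb 2 (lam k) * p k ≤ _
        rcases (hl0 k).eq_or_lt with h | h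
        · rw [h3 k h.symm]
          simp
        · have hlog : Real.logb 2 (lam k) ≤ Real.logb 2 a + (lam k / a - 1) / Real.log 2 := by
            have := Real.log_le_sub_one_of_pos (div_pos h ha)
            rw [Real.log_div h.ne' ha.ne'] at this
            rw [Real.logb, Real.logb, ← add_div]
            exact div_le_div_of_nonneg_right (by linarith) hln.le
          calc _ ≤ (Real.logb 2 a + (lam k / a - 1) / Real.log 2) * p k :=
                mul_le_mul_of_nonneg_right hlog (hp0 k)
            _ = _ := by ring
    _ = Real.logb 2 a + ((∑ k, lam k * p k) / a - 1) / Real.log 2 := by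
        rw [Finset.sum_add_distrib, ← Finset.mul_sum, ← Finset.sum_div, Finset.sum_sub_distrib,
          ← Finset.sum_div, h1, mul_one]
    _ ≤ Real.logb 2 a := by
        have : (∑ k, lam k * p k) / a - 1 ≤ 0 := by
          rw [sub_nonpos, div_le_one ha]
          exact h2
        linarith [div_nonpos_of_nonpos_of_nonneg this hln.le]

theorem le_relEntropy_pureState {n : Type*} [Fintype n] {ψ : EuclideanSpace ℂ n} (hψ : ‖ψ‖ = 1)
    {σ : Matrix n n ℂ} (hσ : σ.PosSemidef) {a : ℝ} (ha : 0 < a)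
    (hle : (pureState ψ * σ).trace.re ≤ a) :
    ((-Real.logb 2 a : ℝ) : EReal) ≤ relEntropy (pureState ψ) σ := by
  classical
  unfold relEntropy
  split_ifs with hsupp
  · rw [EReal.coe_le_coe_iff, cfc_logb_pureState hψ, zero_sub, mul_neg, trace_neg, Complex.neg_re]
    exact neg_le_neg (re_trace_pureState_mul_cfc_logb_le hψ hσ hsupp ha hle)
  · exact le_top

/-- A bound on the overlaps with product vectors bounds the relative entropy of entanglement. -/
theorem le_REE_pureState {N : ℕ} {d : Fin N → ℕ} {ψ : Ket d} (hψ : ‖ψ‖ = 1) {m : ℝ} (hm : 0 < m)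
    (H : ∀ v, ‖overlap ψ v‖ ≤ m * ∏ j, ‖v j‖) :
    ((-Real.logb 2 (m ^ 2) : ℝ) : EReal) ≤ REE (pureState ψ) :=
  le_iInf₂ fun _ hσ => le_relEntropy_pureState hψ (posSemidef_of_mem_SEP hσ) (by positivity)
    (re_trace_pureState_mul_le H hσ)

end QState

/-! ### Union bound over the product net. -/

namespace QState

open MeasureTheory Module

variable {N : ℕ} {d : Fin N → ℕ}

theorem two_pow_le_totalDim (hd : ∀ j, 2 ≤ d j) : 2 ^ N ≤ totalDim d := by
  have := Finset.pow_card_le_prod Finset.univ d 2 fun j _ => hd j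
  simpa [totalDim] using this

theorem two_mul_le_sumDim (hd : ∀ j, 2 ≤ d j) : 2 * N ≤ sumDim d := by
  have := Finset.card_nsmul_le_sum Finset.univ d 2 fun j _ => hd j
  simpa [sumDim, mul_comm] using this

theorem norm_overlap_le {ψ : Ket d} (hψ : ‖ψ‖ = 1)
    (v : (j : Fin N) → EuclideanSpace ℂ (Fin (d j))) : ‖overlap ψ v‖ ≤ ∏ j, ‖v j‖ := by
  rw [← norm_prodKet, ← mul_one ‖prodKet v‖, ← hψ]
  exact norm_inner_le_norm _ _

section Random

variable {E : Type*} [NormedAddCommGroup E] [InnerProductSpace ℝ E] [FiniteDimensional ℝ E]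
  [MeasurableSpace E] [BorelSpace E] [Nontrivial E]

/-- A random pure state has small overlap with all product vectors, with high probability. -/
theorem measureReal_exists_overlap_gt_le [NeZero N] (K : E → Ket d)
    (hK : ∀ w : (j : Fin N) → EuclideanSpace ℂ (Fin (d j)), (∀ j, ‖w j‖ = 1) →
      ∃ e : E, ‖e‖ ≤ 1 ∧ ∀ ψ, (overlap (K ψ) w).re = inner ℝ e ψ) {t : ℝ} (ht : 0 ≤ t) :
    (sphereHaar E).real {ψ | ¬ ∀ v, ‖overlap (K ψ.1) v‖ ≤ √t * ∏ j, ‖v j‖} ≤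
      (1 + 16 * N : ℝ) ^ (2 * sumDim d) * Real.exp (-(3 / 8 * finrank ℝ E * t)) := by
  have hN : (1 : ℝ) ≤ N := by exact_mod_cast NeZero.one_le
  -- Then 1 + 2/δ = 1 + 16N, and Bernoulli gives (1-δ)^(2N) ≥ 1 - 2Nδ = 3/4; halved in the cap
  -- bound, this is the constant 3/8.
  set δ : ℝ := 1 / (8 * N) with hδdef
  have hδ0 : 0 < δ := by positivity
  have hδN : δ * (2 * N) = 1 / 4 := by rw [hδdef]; field_simp; norm_num
  have hδ1 : δ < 1 := by nlinarith
  have hδ' : 0 < 1 - δ := by linarith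
  choose T hT1 hT2 hT3 using fun j => exists_net_sphere (EuclideanSpace ℂ (Fin (d j))) hδ0
  have : ∀ w : (j : Fin N) → EuclideanSpace ℂ (Fin (d j)), ∃ e : E, ‖e‖ ≤ 1 ∧
      ((∀ j, ‖w j‖ = 1) → ∀ ψ, (overlap (K ψ) w).re = inner ℝ e ψ) := fun w => by
    by_cases hw : ∀ j, ‖w j‖ = 1
    · obtain ⟨e, he, h⟩ := hK w hw
      exact ⟨e, he, fun _ => h⟩
    · exact ⟨0, by simp, fun h => absurd h hw⟩
  choose e he1 he2 using this
  set r : ℝ := √t * (1 - δ) ^ N with hr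
  have hr0 : 0 ≤ r := by positivity
  have hr2 : 3 / 4 * t ≤ r ^ 2 := by
    rw [hr, mul_pow, Real.sq_sqrt ht, ← pow_mul, mul_comm]
    gcongr
    have := one_add_mul_le_pow (a := -δ) (by linarith) (N * 2)
    push_cast at this
    rw [← sub_eq_add_neg] at this
    linarith
  have hsub : {ψ : Metric.sphere (0 : E) 1 | ¬ ∀ v, ‖overlap (K ψ.1) v‖ ≤ √t * ∏ j, ‖v j‖} ⊆
      ⋃ w ∈ Fintype.piFinset T, {ψ | r ≤ inner ℝ (e w) ψ.1} := by
    intro ψ hψ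
    by_contra hcon
    simp only [Set.mem_iUnion, not_exists, Fintype.mem_piFinset, Set.mem_ofPred_eq, not_le] at hcon
    refine hψ fun v => ?_
    have h := norm_overlap_le_of_net (ψ := K ψ.1) hr0 hδ1 hT2 (fun w hw => by
      rw [he2 w fun j => hT1 j _ (hw j)]
      exact (hcon w hw).le) v
    rwa [hr, mul_div_assoc, div_self (by positivity), mul_one] at h
  have := isProbabilityMeasure_sphereHaar E
  have hcard : ((Fintype.piFinset T).card : ℝ) ≤ (1 + 16 * N : ℝ) ^ (2 * sumDim d) := by
    -- The factors are always complex, of real dimension 2 d_j, even when E consists of real kets.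
    rw [Fintype.card_piFinset, Nat.cast_prod, sumDim, Finset.mul_sum, ← Finset.prod_pow_eq_pow_sum]
    refine Finset.prod_le_prod (fun _ _ => Nat.cast_nonneg _) fun j _ => (hT3 j).trans_eq ?_
    congr 1
    · rw [hδdef]; field_simp; ring
    · rw [finrank_real_of_complex, finrank_euclideanSpace_fin]
  calc _ ≤ (sphereHaar E).real (⋃ w ∈ Fintype.piFinset T, {ψ | r ≤ inner ℝ (e w) ψ.1}) :=
        measureReal_mono hsub (measure_ne_top _ _)
    _ ≤ ∑ w ∈ Fintype.piFinset T, (sphereHaar E).real {ψ | r ≤ inner ℝ (e w) ψ.1} :=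
        measureReal_biUnion_finset_le _ _
    _ ≤ ∑ w ∈ Fintype.piFinset T, Real.exp (-(3 / 8 * finrank ℝ E * t)) := by
        refine Finset.sum_le_sum fun w _ => (sphereHaar_real_cap_le (he1 w) hr0).trans ?_
        rw [Real.exp_le_exp]
        nlinarith [mul_le_mul_of_nonneg_left hr2 (Nat.cast_nonneg (α := ℝ) (finrank ℝ E))]
    _ ≤ _ := by
        rw [Finset.sum_const, nsmul_eq_mul]
        gcongr

end Random

/-- The value 113 = 1 + 16·7 is what `one_add_sixteen_mul_le` needs for N ≤ 7; from N = 8 on, 2^N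
alone exceeds 1 + 16N. -/
theorem large_totalDim_of_log_lt {D : ℕ} (h8 : 8 ≤ D) (h : 27 * Real.log D < D) : 113 ≤ D := by
  by_contra! hlt
  -- Here 18.7 < 27 ln 2, so D ≥ 2^k gives 27 ln D ≥ 18.7 k. The cases k = 6, 5, 3 cover 8 ≤ D ≤
  -- 112.
  have key : ∀ k : ℕ, 2 ^ k ≤ D → 10 * D ≤ 187 * k → False := fun k hk hDk => by
    have h1 : (2 : ℝ) ^ k ≤ D := by exact_mod_cast hk
    have h2 : k * Real.log 2 ≤ Real.log D := by
      rw [← Real.log_pow]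
      exact Real.log_le_log (by positivity) h1
    have h3 : (10 * D : ℝ) ≤ 187 * k := by exact_mod_cast hDk
    nlinarith [Real.log_two_gt_d9, (Nat.cast_nonneg k : (0 : ℝ) ≤ k)]
  by_cases h64 : 64 ≤ D
  · exact key 6 h64 (by omega)
  by_cases h32 : 32 ≤ D
  · exact key 5 h32 (by omega)
  · exact key 3 h8 (by omega)

theorem one_add_sixteen_mul_le {D : ℕ} (hND : 2 ^ N ≤ D) (hD : 113 ≤ D) : 1 + 16 * N ≤ D := by
  rcases le_or_gt N 7 with h | h
  · omega
  · refine le_trans ?_ hND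
    induction N, h using Nat.le_induction with
    | base => norm_num
    | succ k hk ih =>
      rw [pow_succ]
      have := ih ((Nat.pow_le_pow_right two_pos k.le_succ).trans hND)
      omega

theorem five_mul_le {D : ℕ} (hND : 2 ^ N ≤ D) (hD : 81 ≤ D) : 5 * N ≤ D := by
  rcases le_or_gt N 7 with h | h
  · omega
  · refine le_trans ?_ hND
    induction N, h using Nat.le_induction with
    | base => norm_num
    | succ k hk ih =>
      rw [pow_succ]
      have := ih ((Nat.pow_le_pow_right two_pos k.le_succ).trans hND)
      omega

/-- The value of `Λ²` at the threshold of the geometric measure. -/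
def overlapThreshold (d : Fin N → ℕ) (c : ℝ) : ℝ :=
  c * (sumDim d * Real.log (totalDim d)) / totalDim d

/-! ### Arithmetic turning the union bound into the stated right-hand sides. -/

section Numerics

variable (hN : 3 ≤ N) (hd : ∀ j, 2 ≤ d j)
include hN hd

theorem eight_le_totalDim : 8 ≤ totalDim d :=
  le_trans (by simpa using Nat.pow_le_pow_right two_pos hN) (two_pow_le_totalDim hd)

theorem six_le_sumDim : 6 ≤ sumDim d := by
  have := two_mul_le_sumDim hd
  omega

theorem log_totalDim_pos : 0 < Real.log (totalDim d) := by
  have := eight_le_totalDim hN hd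
  exact Real.log_pos (by exact_mod_cast (by omega : 1 < totalDim d))

theorem overlapThreshold_pos {c : ℝ} (hc : 0 < c) : 0 < overlapThreshold d c := by
  have h8 : (8 : ℝ) ≤ totalDim d := by exact_mod_cast eight_le_totalDim hN hd
  have h6 : (6 : ℝ) ≤ sumDim d := by exact_mod_cast six_le_sumDim hN hd
  have := log_totalDim_pos hN hd
  unfold overlapThreshold
  have : (0 : ℝ) < totalDim d := by linarith
  have : (0 : ℝ) < sumDim d := by linarith
  positivity

theorem neg_logb_overlapThreshold {c : ℝ} (hc : 0 < c) :
    -Real.logb 2 (overlapThreshold d c) = threshold d c := by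
  have h8 : (8 : ℝ) ≤ totalDim d := by exact_mod_cast eight_le_totalDim hN hd
  have h6 : (6 : ℝ) ≤ sumDim d := by exact_mod_cast six_le_sumDim hN hd
  have := log_totalDim_pos hN hd
  have : (totalDim d : ℝ) ≠ 0 := by linarith
  have : (sumDim d : ℝ) ≠ 0 := by linarith
  rw [overlapThreshold, threshold, Real.logb_div (by positivity) (by positivity),
    Real.logb_mul hc.ne' (by positivity)]
  ring

/-- The net costs at most d_T^(2 d_S) once 1 + 16N ≤ d_T, and the exponential is d_T^(-(27/8) d_S);
the surplus 27/8 - 2 = 11/8 exceeds 1. The factor q cancels, which explains the constants 9/2 and 9.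
-/
theorem net_bound_lt_rpow {q : ℝ} (hq1 : 0 < q) (hq2 : q ≤ 2)
    (ht : overlapThreshold d (9 / q) < 1) :
    (1 + 16 * N : ℝ) ^ (2 * sumDim d) *
        Real.exp (-(3 / 8 * (q * totalDim d) * overlapThreshold d (9 / q))) <
      (totalDim d : ℝ) ^ (-(sumDim d : ℝ)) := by
  have h8 : (8 : ℝ) ≤ totalDim d := by exact_mod_cast eight_le_totalDim hN hd
  have h6 : (6 : ℝ) ≤ sumDim d := by exact_mod_cast six_le_sumDim hN hd
  have hlog := log_totalDim_pos hN hd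
  have hD0 : (0 : ℝ) < totalDim d := by linarith
  have hS0 : (0 : ℝ) < sumDim d := by linarith
  -- The constant is (9/2)·6, from 9/q ≥ 9/2 and d_S ≥ 6.
  have h27 : 27 * Real.log (totalDim d) < totalDim d := by
    rw [overlapThreshold, div_lt_one hD0] at ht
    refine lt_of_le_of_lt ?_ ht
    have h92 : 9 / 2 ≤ 9 / q := by gcongr
    calc 27 * Real.log (totalDim d) = 9 / 2 * (6 * Real.log (totalDim d)) := by ring
      _ ≤ _ := by gcongr
  have hND := one_add_sixteen_mul_le (two_pow_le_totalDim hd)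
    (large_totalDim_of_log_lt (eight_le_totalDim hN hd) h27)
  have hND' : (1 + 16 * N : ℝ) ≤ totalDim d := by exact_mod_cast hND
  calc _ ≤ (totalDim d : ℝ) ^ (2 * sumDim d) *
        Real.exp (-(3 / 8 * (q * totalDim d) * overlapThreshold d (9 / q))) := by gcongr
    _ = Real.exp (2 * sumDim d * Real.log (totalDim d)) *
        Real.exp (-(27 / 8 * (sumDim d * Real.log (totalDim d)))) := by
        congr 2
        · rw [← Real.rpow_natCast, Real.rpow_def_of_pos hD0]
          push_cast
          ring_nf
        · rw [overlapThreshold]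
          field_simp
          norm_num
    _ < _ := by
        rw [← Real.exp_add, Real.rpow_def_of_pos hD0, Real.exp_lt_exp]
        nlinarith [mul_pos hS0 hlog]

theorem neg_logb_inv_sqrt :
    -Real.logb 2 (√(totalDim d : ℝ))⁻¹ = 1 / 2 * Real.logb 2 (totalDim d) := by
  have h8 : (8 : ℝ) ≤ totalDim d := by exact_mod_cast eight_le_totalDim hN hd
  rw [Real.logb_inv, neg_neg, Real.sqrt_eq_rpow, Real.logb_rpow_eq_mul_logb_of_pos (by linarith)]

/-- For small d_T the probability bound is vacuous: (q/3)√d_T < (2/3)·9 = 6, while d_S ≥ 6 and the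
logarithm is at least 1. -/
theorem one_lt_expBound {q : ℝ} (hq1 : 0 < q) (hq2 : q ≤ 2) (hD : totalDim d < 81) :
    1 < expBound d (q / 3) := by
  have h8 : (8 : ℝ) ≤ totalDim d := by exact_mod_cast eight_le_totalDim hN hd
  have h6 : (6 : ℝ) ≤ sumDim d := by exact_mod_cast six_le_sumDim hN hd
  have hN' : (3 : ℝ) ≤ N := by exact_mod_cast hN
  have hs : √(totalDim d : ℝ) < 9 := by
    rw [Real.sqrt_lt' (by norm_num)]
    norm_num
    exact_mod_cast hD
  have hs0 := Real.sqrt_nonneg (totalDim d : ℝ)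
  have hl : 1 ≤ Real.log (59 * N * totalDim d) := by
    rw [Real.le_log_iff_exp_le (by positivity)]
    nlinarith [Real.exp_one_lt_d9]
  rw [expBound, Real.one_lt_exp_iff]
  nlinarith

theorem net_bound_lt_expBound {q : ℝ} (hq1 : 0 < q) (hD : 81 ≤ totalDim d) :
    (1 + 16 * N : ℝ) ^ (2 * sumDim d) *
        Real.exp (-(3 / 8 * (q * totalDim d) * (√(totalDim d : ℝ))⁻¹)) <
      expBound d (q / 3) := by
  have hN' : (3 : ℝ) ≤ N := by exact_mod_cast hN
  have h5 : (5 * N : ℝ) ≤ totalDim d := by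
    exact_mod_cast five_mul_le (two_pow_le_totalDim hd) hD
  have hD0 : (0 : ℝ) < totalDim d := by linarith
  have hs0 : 0 < √(totalDim d : ℝ) := Real.sqrt_pos.2 hD0
  -- With d_T ≥ 5N the right side is at least 295N², which beats 256N² + 32N + 1 for N ≥ 3.
  have h59 : (1 + 16 * N : ℝ) ^ 2 ≤ 59 * N * totalDim d := by nlinarith
  have hpos : (0 : ℝ) < 59 * N * totalDim d := by positivity
  have hdiv : (totalDim d : ℝ) * (√(totalDim d : ℝ))⁻¹ = √(totalDim d : ℝ) := by
    rw [← div_eq_mul_inv, Real.div_sqrt]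
  calc _ ≤ (59 * N * totalDim d : ℝ) ^ sumDim d *
        Real.exp (-(3 / 8 * (q * totalDim d) * (√(totalDim d : ℝ))⁻¹)) := by
        rw [pow_mul]
        gcongr
    _ = Real.exp (sumDim d * Real.log (59 * N * totalDim d)) *
        Real.exp (-(3 / 8 * (q * √(totalDim d : ℝ)))) := by
        congr 2
        · rw [← Real.rpow_natCast, Real.rpow_def_of_pos hpos, mul_comm]
        · rw [mul_assoc, mul_assoc, hdiv]
    _ < _ := by
        rw [← Real.exp_add, expBound, Real.exp_lt_exp]
        -- Strictness comes from 3/8 > 1/3.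
        nlinarith [mul_pos hq1 hs0]

end Numerics

/-! ### From entanglement to overlaps, and the final bounds. -/

/-- The states of small entanglement have large overlap with a product vector. -/
theorem entanglement_events_subset {E : Type*} [NormedAddCommGroup E] (hN : 3 ≤ N) (hd : ∀ j, 2 ≤ d j) (K : E → Ket d)
    (hK : ∀ ψ, ‖K ψ‖ = ‖ψ‖) {t τ : ℝ} (ht : 0 < t) (hτ : -Real.logb 2 t = τ) :
    {ψ : Metric.sphere (0 : E) 1 | GM (pureState (K ψ.1)) < τ} ⊆
        {ψ | ¬ ∀ v, ‖overlap (K ψ.1) v‖ ≤ √t * ∏ j, ‖v j‖} ∧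
      {ψ : Metric.sphere (0 : E) 1 | REE (pureState (K ψ.1)) < (τ : EReal) ∨
          LGR (pureState (K ψ.1)) < τ} ⊆
        {ψ | ¬ ∀ v, ‖overlap (K ψ.1) v‖ ≤ √t * ∏ j, ‖v j‖} := by
  have hs : √t ^ 2 = t := Real.sq_sqrt ht.le
  have hs0 : 0 < √t := Real.sqrt_pos.2 ht
  have hD : 2 ≤ totalDim d := by linarith [eight_le_totalDim hN hd]
  have hn : ∀ ψ : Metric.sphere (0 : E) 1, ‖K ψ.1‖ = 1 := fun ψ => by simp [hK]
  subst hτ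
  constructor
  · intro ψ hψ H
    have := le_GM_pureState (hn ψ) H
    rw [hs] at this
    exact absurd hψ (not_lt.2 this)
  · rintro ψ (hψ | hψ) H
    · have := le_REE_pureState (hn ψ) hs0 H
      rw [hs] at this
      exact absurd hψ (not_lt.2 this)
    · have := le_LGR_pureState (fun j => two_pos.trans_le (hd j)) hD (hn ψ) hs0 H
      rw [hs] at this
      exact absurd hψ (not_lt.2 this)

section Main

variable {E : Type*} [NormedAddCommGroup E] [InnerProductSpace ℝ E] [FiniteDimensional ℝ E]
  [MeasurableSpace E] [BorelSpace E] [Nontrivial E]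

theorem measureReal_large_overlap_lt_rpow (hN : 3 ≤ N) (hd : ∀ j, 2 ≤ d j) (K : E → Ket d)
    (hK : ∀ ψ, ‖K ψ‖ = ‖ψ‖)
    (hK' : ∀ w : (j : Fin N) → EuclideanSpace ℂ (Fin (d j)), (∀ j, ‖w j‖ = 1) →
      ∃ e : E, ‖e‖ ≤ 1 ∧ ∀ ψ, (overlap (K ψ) w).re = inner ℝ e ψ)
    {q : ℝ} (hq1 : 0 < q) (hq2 : q ≤ 2) (hE : (finrank ℝ E : ℝ) = q * totalDim d) :
    (sphereHaar E).real
        {ψ | ¬ ∀ v, ‖overlap (K ψ.1) v‖ ≤ √(overlapThreshold d (9 / q)) * ∏ j, ‖v j‖} <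
      (totalDim d : ℝ) ^ (-(sumDim d : ℝ)) := by
  have : NeZero N := ⟨by omega⟩
  have h8 := eight_le_totalDim hN hd
  have hD0 : (0 : ℝ) < totalDim d := by exact_mod_cast (by omega : 0 < totalDim d)
  rcases lt_or_ge (overlapThreshold d (9 / q)) 1 with ht | ht
  · refine (measureReal_exists_overlap_gt_le K hK'
      (overlapThreshold_pos hN hd (by positivity)).le).trans_lt ?_
    rw [hE]
    exact net_bound_lt_rpow hN hd hq1 hq2 ht
  -- For a threshold of at least 1, Cauchy–Schwarz makes the event empty.
  · have hempty : {ψ : Metric.sphere (0 : E) 1 | ¬ ∀ v, ‖overlap (K ψ.1) v‖ ≤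
        √(overlapThreshold d (9 / q)) * ∏ j, ‖v j‖} = ∅ := by
      refine Set.eq_empty_iff_forall_notMem.2 fun ψ hψ => hψ fun v => ?_
      refine (norm_overlap_le (by simp [hK]) v).trans
        (le_mul_of_one_le_left (Finset.prod_nonneg fun _ _ => norm_nonneg _) ?_)
      rwa [Real.one_le_sqrt]
    rw [hempty, measureReal_empty]
    positivity

theorem measureReal_large_overlap_lt_expBound (hN : 3 ≤ N) (hd : ∀ j, 2 ≤ d j) (K : E → Ket d)
    (hK' : ∀ w : (j : Fin N) → EuclideanSpace ℂ (Fin (d j)), (∀ j, ‖w j‖ = 1) →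
      ∃ e : E, ‖e‖ ≤ 1 ∧ ∀ ψ, (overlap (K ψ) w).re = inner ℝ e ψ)
    {q : ℝ} (hq1 : 0 < q) (hq2 : q ≤ 2) (hE : (finrank ℝ E : ℝ) = q * totalDim d) :
    (sphereHaar E).real
        {ψ | ¬ ∀ v, ‖overlap (K ψ.1) v‖ ≤ √(√(totalDim d : ℝ))⁻¹ * ∏ j, ‖v j‖} <
      expBound d (q / 3) := by
  have : NeZero N := ⟨by omega⟩
  rcases lt_or_ge (totalDim d) 81 with hD | hD
  · have := isProbabilityMeasure_sphereHaar E
    exact measureReal_le_one.trans_lt (one_lt_expBound hN hd hq1 hq2 hD)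
  · refine (measureReal_exists_overlap_gt_le K hK' (by positivity)).trans_lt ?_
    rw [hE]
    exact net_bound_lt_expBound hN hd hq1 hD

/-- The four bounds for a random vector of a real inner product space of kets. -/
theorem concentration_bounds (hN : 3 ≤ N) (hd : ∀ j, 2 ≤ d j) (K : E → Ket d)
    (hK : ∀ ψ, ‖K ψ‖ = ‖ψ‖)
    (hK' : ∀ w : (j : Fin N) → EuclideanSpace ℂ (Fin (d j)), (∀ j, ‖w j‖ = 1) →
      ∃ e : E, ‖e‖ ≤ 1 ∧ ∀ ψ, (overlap (K ψ) w).re = inner ℝ e ψ)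
    {q : ℝ} (hq1 : 0 < q) (hq2 : q ≤ 2) (hE : (finrank ℝ E : ℝ) = q * totalDim d) :
    ((sphereHaar E).real {ψ | GM (pureState (K ψ.1)) < threshold d (9 / q)} <
        (totalDim d : ℝ) ^ (-(sumDim d : ℝ)) ∧
      (sphereHaar E).real {ψ | GM (pureState (K ψ.1)) < 1 / 2 * Real.logb 2 (totalDim d)} <
        expBound d (q / 3)) ∧
    (sphereHaar E).real {ψ | REE (pureState (K ψ.1)) < ((threshold d (9 / q) : ℝ) : EReal) ∨
          LGR (pureState (K ψ.1)) < threshold d (9 / q)} <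
        (totalDim d : ℝ) ^ (-(sumDim d : ℝ)) ∧
      (sphereHaar E).real {ψ | REE (pureState (K ψ.1)) <
            ((1 / 2 * Real.logb 2 (totalDim d) : ℝ) : EReal) ∨
          LGR (pureState (K ψ.1)) < 1 / 2 * Real.logb 2 (totalDim d)} <
        expBound d (q / 3) := by
  have := isProbabilityMeasure_sphereHaar E
  have hc : 0 < 9 / q := by positivity
  have h8 := eight_le_totalDim hN hd
  have hD0 : (0 : ℝ) < totalDim d := by exact_mod_cast (by omega : 0 < totalDim d)
  obtain ⟨a1, a2⟩ := entanglement_events_subset hN hd K hK (overlapThreshold_pos hN hd hc)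
    (neg_logb_overlapThreshold hN hd hc)
  obtain ⟨b1, b2⟩ := entanglement_events_subset hN hd K hK (inv_pos.2 (Real.sqrt_pos.2 hD0))
    (neg_logb_inv_sqrt hN hd)
  have h1 := measureReal_large_overlap_lt_rpow hN hd K hK hK' hq1 hq2 hE
  have h2 := measureReal_large_overlap_lt_expBound hN hd K hK' hq1 hq2 hE
  exact ⟨⟨(measureReal_mono a1).trans_lt h1, (measureReal_mono b1).trans_lt h2⟩,
    (measureReal_mono a2).trans_lt h1, (measureReal_mono b2).trans_lt h2⟩

end Main

theorem nonempty_Idx (hd : ∀ j, 2 ≤ d j) : Nonempty (Idx d) :=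
  ⟨fun j => ⟨0, two_pos.trans_le (hd j)⟩⟩

theorem exists_real_inner_eq_overlap_re {w : (j : Fin N) → EuclideanSpace ℂ (Fin (d j))}
    (hw : ∀ j, ‖w j‖ = 1) :
    ∃ e : Ket d, ‖e‖ ≤ 1 ∧ ∀ ψ, (overlap ψ w).re = inner ℝ e ψ := by
  refine ⟨prodKet w, ?_, fun ψ => ?_⟩
  · rw [norm_prodKet]
    simp [hw]
  · simp [overlap, PiLp.inner_apply, Complex.inner]

theorem norm_toKet (ψ : RealKet d) : ‖RealKet.toKet ψ‖ = ‖ψ‖ := by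
  simp [EuclideanSpace.norm_eq, RealKet.toKet]

/-- Against a real ψ only the entrywise real part of the product vector matters. Its norm may be
less than 1, which is why the cap bound admits every ‖e‖ ≤ 1. -/
theorem exists_real_inner_eq_overlap_toKet_re {w : (j : Fin N) → EuclideanSpace ℂ (Fin (d j))}
    (hw : ∀ j, ‖w j‖ = 1) :
    ∃ e : RealKet d, ‖e‖ ≤ 1 ∧ ∀ ψ, (overlap (RealKet.toKet ψ) w).re = inner ℝ e ψ := by
  refine ⟨WithLp.toLp 2 fun i => (prodKet w i).re, ?_, fun ψ => ?_⟩
  · have h1 : ‖prodKet w‖ = 1 := by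
      rw [norm_prodKet]
      simp [hw]
    rw [← h1, EuclideanSpace.norm_eq, EuclideanSpace.norm_eq]
    gcongr with i
    exact Complex.abs_re_le_norm _
  · simp [overlap, PiLp.inner_apply, RealKet.toKet]

end QState

end

theorem mainTheorem4 (N : ℕ) (hN : 3 ≤ N) (d : Fin N → ℕ) (hd : ∀ j, 2 ≤ d j) :
    -- geometric measure, Haar-random pure states
    (QState.haarPure d).real {ψ | QState.GM (QState.pureState ψ.1) < QState.threshold d (9 / 2)} <
        (QState.totalDim d : ℝ) ^ (-(QState.sumDim d : ℝ)) ∧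
    (QState.haarPure d).real {ψ | QState.GM (QState.pureState ψ.1) <
          1 / 2 * Real.logb 2 (QState.totalDim d)} <
        QState.expBound d (2 / 3) ∧
    -- geometric measure, Haar-random real pure states
    (QState.haarReal d).real {ψ | QState.GM (QState.pureState (QState.RealKet.toKet ψ.1)) <
          QState.threshold d 9} <
        (QState.totalDim d : ℝ) ^ (-(QState.sumDim d : ℝ)) ∧
    (QState.haarReal d).real {ψ | QState.GM (QState.pureState (QState.RealKet.toKet ψ.1)) <
          1 / 2 * Real.logb 2 (QState.totalDim d)} <
        QState.expBound d (1 / 3) ∧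
    -- relative entropy of entanglement or logarithmic robustness, Haar-random pure states
    (QState.haarPure d).real {ψ |
          QState.REE (QState.pureState ψ.1) < ((QState.threshold d (9 / 2) : ℝ) : EReal) ∨
          QState.LGR (QState.pureState ψ.1) < QState.threshold d (9 / 2)} <
        (QState.totalDim d : ℝ) ^ (-(QState.sumDim d : ℝ)) ∧
    (QState.haarPure d).real {ψ |
          QState.REE (QState.pureState ψ.1) <
            ((1 / 2 * Real.logb 2 (QState.totalDim d) : ℝ) : EReal) ∨
          QState.LGR (QState.pureState ψ.1) < 1 / 2 * Real.logb 2 (QState.totalDim d)} <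
        QState.expBound d (2 / 3) ∧
    -- relative entropy of entanglement or logarithmic robustness, Haar-random real pure states
    (QState.haarReal d).real {ψ |
          QState.REE (QState.pureState (QState.RealKet.toKet ψ.1)) <
            ((QState.threshold d 9 : ℝ) : EReal) ∨
          QState.LGR (QState.pureState (QState.RealKet.toKet ψ.1)) < QState.threshold d 9} <
        (QState.totalDim d : ℝ) ^ (-(QState.sumDim d : ℝ)) ∧
    (QState.haarReal d).real {ψ |
          QState.REE (QState.pureState (QState.RealKet.toKet ψ.1)) <
            ((1 / 2 * Real.logb 2 (QState.totalDim d) : ℝ) : EReal) ∨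
          QState.LGR (QState.pureState (QState.RealKet.toKet ψ.1)) <
            1 / 2 * Real.logb 2 (QState.totalDim d)} <
        QState.expBound d (1 / 3) := by
  have := QState.nonempty_Idx hd
  obtain ⟨⟨a1, a2⟩, a3, a4⟩ := QState.concentration_bounds (E := QState.Ket d) hN hd id
    (fun _ => rfl) (fun _ hw => QState.exists_real_inner_eq_overlap_re hw) two_pos le_rfl (by
      rw [finrank_real_of_complex, finrank_euclideanSpace, QState.card_Idx]
      push_cast
      rfl)
  obtain ⟨⟨b1, b2⟩, b3, b4⟩ := QState.concentration_bounds (E := QState.RealKet d) hN hd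
    QState.RealKet.toKet QState.norm_toKet
    (fun _ hw => QState.exists_real_inner_eq_overlap_toKet_re hw) one_pos one_le_two (by
      rw [finrank_euclideanSpace, QState.card_Idx, one_mul])
  rw [div_one] at b1 b3
  exact ⟨a1, a2, b1, b2, a3, a4, b3, b4⟩
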